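/- Let $n$ and $k$ be integers with $1\le k\le n-1$. Let $\mathcal N_{n,k}$ be the real vector space of complex $n\times n$ skew-Hermitian matrices of bandwidth $k$, that is, of all $A\in\mathbb C^{n\times n}$ with $A^*=-A$ and $A_{ij}=0$ whenever $|i-j|>k$. Let $\mathcal D_{n,k}\subset\mathcal N_{n,k}$ be the subset of derogatory matrices, i.e. of those with an eigenvalue of geometric multiplicity greater than $1$. Then $\mathcal D_{n,k}$ has real codimension $3$ in $\mathcal N_{n,k}$: $\dim_{\mathbb R}\mathcal N_{n,k}-\dim_{\mathbb R}\mathcal D_{n,k}=3$. Here a subset $S$ of a finite-dimensional real vector space (possibly with singular points) is said to have dimension $d$ if some nonempty relatively open subset of $S$ is a smooth embedded submanifold of dimension $d$, and $S$ is contained in a countable union of smooth embedded submanifolds of dimension at most $d$. -/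

import Mathlib

open scoped ContDiff Matrix

-- Smoothness is independent of the choice of a norm on the (finite-dimensional) matrix spaces.
attribute [local instance] Matrix.frobeniusNormedAddCommGroup Matrix.frobeniusNormedSpace

/-- `M` is a smooth embedded submanifold, of dimension `d`, of the finite-dimensional real vector
space `E`: around each of its points there is a smooth chart `φ` of `E` which maps `M` onto (an open
piece of) a `d`-dimensional linear subspace. (The empty set is a submanifold of every dimension.) -/
def IsEmbeddedSubmanifold {E : Type*} [NormedAddCommGroup E] [NormedSpace ℝ E]
    (M : Set E) (d : ℕ) : Prop :=
  ∀ x ∈ M, ∃ (φ : OpenPartialHomeomorph E E) (F : Submodule ℝ E),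
    x ∈ φ.source ∧
    ContDiffOn ℝ ∞ φ φ.source ∧ ContDiffOn ℝ ∞ φ.symm φ.target ∧
    Module.finrank ℝ F = d ∧
    ∀ y ∈ φ.source, (y ∈ M ↔ φ y ∈ F)

/-- The subset `S` of `E`, possibly with singular points, has dimension `d`: a nonempty relatively
open part of `S` is an embedded submanifold of dimension `d`, and `S` is contained in a
countable union of embedded submanifolds of dimension at most `d`. There is at most one such `d`,
and for a nonempty embedded submanifold it is the dimension in the usual sense. -/
def HasDimension {E : Type*} [NormedAddCommGroup E] [NormedSpace ℝ E]
    (S : Set E) (d : ℕ) : Prop :=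
  (∃ U : Set E, IsOpen U ∧ (S ∩ U).Nonempty ∧ IsEmbeddedSubmanifold (S ∩ U) d) ∧
  ∃ M : ℕ → Set E, (∀ i, ∃ e ≤ d, IsEmbeddedSubmanifold (M i) e) ∧ S ⊆ ⋃ i, M i

/-- `S` has codimension `c` in the real vector space `E`: `dim E - dim S = c`. -/
def HasCodimension {E : Type*} [NormedAddCommGroup E] [NormedSpace ℝ E]
    (S : Set E) (c : ℕ) : Prop :=
  ∃ d : ℕ, HasDimension S d ∧ Module.finrank ℝ E = d + c

/-- The entries of `A` vanish at distance more than `k` from the diagonal. -/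
def IsBanded {n : ℕ} (k : ℕ) (A : Matrix (Fin n) (Fin n) ℂ) : Prop :=
  ∀ i j : Fin n, (k : ℤ) < |(j : ℤ) - (i : ℤ)| → A i j = 0

/-- `A` is derogatory: some eigenvalue has geometric multiplicity greater than one. -/
def IsDerogatory {n : ℕ} (A : Matrix (Fin n) (Fin n) ℂ) : Prop :=
  ∃ μ : ℂ, 1 < Module.finrank ℂ (Module.End.eigenspace (Matrix.toLin' A) μ)

/-- The real vector space of `n × n` complex skew-Hermitian matrices of bandwidth `k`. -/
def skewHermitianBanded (n k : ℕ) : Submodule ℝ (Matrix (Fin n) (Fin n) ℂ) where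
  carrier := {A | Aᴴ = -A ∧ IsBanded k A}
  add_mem' := by
    rintro A B ⟨hA, hA'⟩ ⟨hB, hB'⟩
    refine ⟨?_, fun i j h => ?_⟩
    · rw [Matrix.conjTranspose_add, hA, hB, neg_add]
    · rw [Matrix.add_apply, hA' i j h, hB' i j h, add_zero]
  zero_mem' := ⟨by simp, fun _ _ _ => rfl⟩
  smul_mem' := by
    rintro c A ⟨hA, hA'⟩
    refine ⟨?_, fun i j h => ?_⟩
    · rw [Matrix.conjTranspose_smul, hA, smul_neg, star_trivial]
    · rw [Matrix.smul_apply, hA' i j h, smul_zero]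

/-- The derogatory matrices among the skew-Hermitian matrices of bandwidth `k`. -/
def derogatorySkewHermitianBanded (n k : ℕ) : Set (skewHermitianBanded n k) :=
  {A | IsDerogatory (A : Matrix (Fin n) (Fin n) ℂ)}

section Submanifolds

variable {E : Type*} [NormedAddCommGroup E] [NormedSpace ℝ E]

/-- The inverse function theorem for smooth maps of a finite-dimensional space, with an inverse
which is smooth on an open set. -/
theorem exists_smooth_chart [FiniteDimensional ℝ E] {T : E → E} {U : Set E} (hU : IsOpen U)
    (hT : ∀ x ∈ U, ContDiffAt ℝ ∞ T x)
    (hinj : ∀ x ∈ U, ∀ H, fderiv ℝ T x H = 0 → H = 0) {x : E} (hx : x ∈ U) :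
    ∃ Φ : OpenPartialHomeomorph E E, x ∈ Φ.source ∧ Φ.source ⊆ U ∧ (∀ y, Φ y = T y) ∧
      ContDiffOn ℝ ∞ Φ Φ.source ∧ ContDiffOn ℝ ∞ Φ.symm Φ.target := by
  have : CompleteSpace E := FiniteDimensional.complete ℝ E
  have key : ∀ y ∈ U, ∃ f' : E ≃L[ℝ] E, HasFDerivAt T (f' : E →L[ℝ] E) y := by
    intro y hy
    have hi : Function.Injective (fderiv ℝ T y : E →ₗ[ℝ] E) := by
      refine (injective_iff_map_eq_zero _).2 (hinj y hy)
    refine ⟨(LinearEquiv.ofInjectiveEndo _ hi).toContinuousLinearEquiv, ?_⟩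
    have h := ((hT y hy).differentiableAt (by simp)).hasFDerivAt
    convert h using 1
    ext v
    rfl
  obtain ⟨f', hf'⟩ := key x hx
  let Φ := ((hT x hx).toOpenPartialHomeomorph T hf' (by simp)).restrOpen U hU
  have hsrc : Φ.source ⊆ U := fun y hy => hy.2
  have hΦ : (Φ : E → E) = T := rfl
  refine ⟨Φ, ⟨(hT x hx).mem_toOpenPartialHomeomorph_source hf' (by simp), hx⟩, hsrc,
    fun _ => rfl, fun y hy => ((hT y (hsrc hy)).contDiffWithinAt), fun y hy => ?_⟩
  have hy' := hsrc (Φ.map_target hy)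
  obtain ⟨g', hg'⟩ := key _ hy'
  exact (Φ.contDiffAt_symm (f₀' := g') hy (hΦ ▸ hg') (hΦ ▸ hT _ hy')).contDiffWithinAt

/-- A diffeomorphism between open sets maps the pieces of a subspace to submanifolds. -/
theorem isEmbeddedSubmanifold_of_chart {M : Set E} (Φ : OpenPartialHomeomorph E E)
    (h₁ : ContDiffOn ℝ ∞ Φ Φ.source) (h₂ : ContDiffOn ℝ ∞ Φ.symm Φ.target)
    (F : Submodule ℝ E) (hM : M ⊆ Φ.target) {V : Set E} (hV : IsOpen V) (hMV : M ⊆ V)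
    (h : ∀ y ∈ Φ.target, y ∈ V → (y ∈ M ↔ Φ.symm y ∈ F)) :
    IsEmbeddedSubmanifold M (Module.finrank ℝ F) := by
  intro x hx
  refine ⟨Φ.symm.restrOpen V hV, F, ⟨hM hx, hMV hx⟩, h₂.mono fun y hy => hy.1,
    h₁.mono ?_, rfl, fun y hy => h y hy.1 hy.2⟩
  intro y hy
  exact hy.1

/-- A countable union of `d`-dimensional embedded submanifolds contains `S`. -/
def CoveredBySubmanifolds (S : Set E) (d : ℕ) : Prop :=
  ∃ 𝓜 : Set (Set E), 𝓜.Countable ∧ (∀ M ∈ 𝓜, IsEmbeddedSubmanifold M d) ∧ S ⊆ ⋃₀ 𝓜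

theorem CoveredBySubmanifolds.iUnion {ι : Type*} [Countable ι] {S : ι → Set E} {d : ℕ}
    (h : ∀ i, CoveredBySubmanifolds (S i) d) : CoveredBySubmanifolds (⋃ i, S i) d := by
  choose 𝓜 h₁ h₂ h₃ using h
  refine ⟨⋃ i, 𝓜 i, Set.countable_iUnion h₁, fun M hM => ?_, Set.iUnion_subset fun i => ?_⟩
  · obtain ⟨i, hi⟩ := Set.mem_iUnion.1 hM
    exact h₂ i M hi
  · exact (h₃ i).trans (Set.sUnion_subset_sUnion (Set.subset_iUnion 𝓜 i))

theorem CoveredBySubmanifolds.mono {S S' : Set E} {d : ℕ} (h : CoveredBySubmanifolds S d)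
    (hS : S' ⊆ S) : CoveredBySubmanifolds S' d :=
  let ⟨𝓜, h₁, h₂, h₃⟩ := h
  ⟨𝓜, h₁, h₂, hS.trans h₃⟩

theorem CoveredBySubmanifolds.exists_seq {S : Set E} {d : ℕ} (h : CoveredBySubmanifolds S d) :
    ∃ M : ℕ → Set E, (∀ i, ∃ e ≤ d, IsEmbeddedSubmanifold (M i) e) ∧ S ⊆ ⋃ i, M i := by
  obtain ⟨𝓜, h₁, h₂, h₃⟩ := h
  obtain ⟨M, hM⟩ := (h₁.insert ∅).exists_eq_range (Set.insert_nonempty _ _)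
  refine ⟨M, fun i => ⟨d, le_rfl, ?_⟩, fun x hx => ?_⟩
  · have : M i ∈ insert ∅ 𝓜 := hM ▸ Set.mem_range_self i
    rcases this with h | h
    · rw [h]
      exact fun x hx => hx.elim
    · exact h₂ _ h
  · obtain ⟨N, hN, hx⟩ := h₃ hx
    obtain ⟨i, rfl⟩ : N ∈ Set.range M := hM ▸ Set.mem_insert_of_mem _ hN
    exact Set.mem_iUnion.2 ⟨i, hx⟩

/-- The image of a subspace under a smooth map with injective differentials is contained in a
countable union of embedded submanifolds of the same dimension. -/
theorem coveredBySubmanifolds_image [FiniteDimensional ℝ E] {T : E → E} {U : Set E}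
    (hU : IsOpen U) (hT : ∀ x ∈ U, ContDiffAt ℝ ∞ T x)
    (hinj : ∀ x ∈ U, ∀ H, fderiv ℝ T x H = 0 → H = 0) (F : Submodule ℝ E) :
    CoveredBySubmanifolds (T '' (U ∩ F)) (Module.finrank ℝ F) := by
  have : SecondCountableTopology E := by
    have : ProperSpace E := FiniteDimensional.proper ℝ E
    infer_instance
  have : Nonempty (OpenPartialHomeomorph E E) := ⟨OpenPartialHomeomorph.refl E⟩
  choose! Φ h₁ h₂ h₃ h₄ h₅ using fun x (hx : x ∈ U) => exists_smooth_chart hU hT hinj hx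
  obtain ⟨t, htU, ht, hcov⟩ := TopologicalSpace.countable_cover_nhdsWithin
    (f := fun x => (Φ x).source) (s := U)
    fun x hx => mem_nhdsWithin_of_mem_nhds ((Φ x).open_source.mem_nhds (h₁ x hx))
  refine ⟨(fun x => T '' ((Φ x).source ∩ F)) '' t, ht.image _, ?_, ?_⟩
  · rintro _ ⟨x, hx, rfl⟩
    have hx := htU hx
    refine isEmbeddedSubmanifold_of_chart (Φ x) (h₄ x hx) (h₅ x hx) F ?_ isOpen_univ
      (Set.subset_univ _) ?_
    · rintro _ ⟨y, hy, rfl⟩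
      rw [← h₃ x hx]
      exact (Φ x).map_source hy.1
    · intro y hy _
      constructor
      · rintro ⟨z, hz, rfl⟩
        rw [← h₃ x hx, (Φ x).left_inv hz.1]
        exact hz.2
      · intro h
        exact ⟨_, ⟨(Φ x).map_target hy, h⟩, by rw [← h₃ x hx, (Φ x).right_inv hy]⟩
  · rintro _ ⟨y, hy, rfl⟩
    obtain ⟨x, hx, hyx⟩ := Set.mem_iUnion₂.1 (hcov hy.1)
    exact ⟨_, ⟨x, hx, rfl⟩, ⟨y, ⟨hyx, hy.2⟩, rfl⟩⟩

end Submanifolds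

section SchurComplement

variable {n : ℕ}

/-- The orthogonal projection onto the coordinates outside `J`. -/
def offProj (J : Finset (Fin n)) : Matrix (Fin n) (Fin n) ℂ :=
  Matrix.diagonal fun i => if i ∈ J then 0 else 1

theorem offProj_mul_offProj (J : Finset (Fin n)) : offProj J * offProj J = offProj J := by
  simp [offProj]

theorem conjTranspose_offProj (J : Finset (Fin n)) : (offProj J)ᴴ = offProj J := by
  rw [offProj, Matrix.diagonal_conjTranspose]
  congr 1
  ext i
  by_cases h : i ∈ J <;> simp [h]

/-- The block of `B - μ` with indices outside `J`, extended by the identity. -/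
noncomputable def offBlock (J : Finset (Fin n)) (B : Matrix (Fin n) (Fin n) ℂ) (μ : ℂ) :
    Matrix (Fin n) (Fin n) ℂ :=
  offProj J * (B - μ • 1) * offProj J + (1 - offProj J)

/-- The correction term of the Schur complement of the block of `B - μ` outside `J`. -/
noncomputable def schurTerm (J : Finset (Fin n)) (B : Matrix (Fin n) (Fin n) ℂ) (μ : ℂ) :
    Matrix (Fin n) (Fin n) ℂ :=
  B * offProj J * (offBlock J B μ)⁻¹ * (offProj J * B)

theorem offBlock_congr {J : Finset (Fin n)} {B B' : Matrix (Fin n) (Fin n) ℂ}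
    (h : offProj J * B = offProj J * B') (μ : ℂ) : offBlock J B μ = offBlock J B' μ := by
  simp only [offBlock, mul_sub, h]

theorem schurTerm_congr {J : Finset (Fin n)} {B B' : Matrix (Fin n) (Fin n) ℂ}
    (h : offProj J * B = offProj J * B') (h' : B * offProj J = B' * offProj J) (μ : ℂ) :
    schurTerm J B μ = schurTerm J B' μ := by
  simp only [schurTerm, h, h', offBlock_congr h]

theorem offProj_mul_offBlock (J : Finset (Fin n)) (B : Matrix (Fin n) (Fin n) ℂ) (μ : ℂ) :
    offProj J * offBlock J B μ = offProj J * (B - μ • 1) * offProj J := by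
  simp [offBlock, mul_add, mul_sub, ← mul_assoc, offProj_mul_offProj]

theorem offBlock_mul_offProj (J : Finset (Fin n)) (B : Matrix (Fin n) (Fin n) ℂ) (μ : ℂ) :
    offBlock J B μ * offProj J = offProj J * (B - μ • 1) * offProj J := by
  simp [offBlock, add_mul, sub_mul, mul_assoc, offProj_mul_offProj]

/-- The projection commutes with the inverse of the block. -/
theorem offProj_mul_inv {J : Finset (Fin n)} {B : Matrix (Fin n) (Fin n) ℂ} {μ : ℂ}
    (h : IsUnit (offBlock J B μ).det) :
    offProj J * (offBlock J B μ)⁻¹ = (offBlock J B μ)⁻¹ * offProj J := by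
  have h1 : (offBlock J B μ)⁻¹ * (offBlock J B μ * offProj J) * (offBlock J B μ)⁻¹ =
      (offBlock J B μ)⁻¹ * (offProj J * offBlock J B μ) * (offBlock J B μ)⁻¹ := by
    rw [offBlock_mul_offProj, offProj_mul_offBlock]
  rwa [← mul_assoc, Matrix.nonsing_inv_mul _ h, one_mul, mul_assoc, mul_assoc,
    Matrix.mul_nonsing_inv _ h, mul_one] at h1

theorem conjTranspose_inv_offBlock {J : Finset (Fin n)} {B : Matrix (Fin n) (Fin n) ℂ} {μ : ℂ}
    (hB : Bᴴ = -B) (hμ : star μ = -μ) (h : IsUnit (offBlock J B μ).det) :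
    (offProj J * (offBlock J B μ)⁻¹)ᴴ = -(offProj J * (offBlock J B μ)⁻¹) := by
  have hs : (B - μ • (1 : Matrix (Fin n) (Fin n) ℂ))ᴴ = -(B - μ • 1) := by
    rw [Matrix.conjTranspose_sub, Matrix.conjTranspose_smul, hB, hμ, Matrix.conjTranspose_one]
    module
  have hu : IsUnit ((offBlock J B μ)ᴴ).det := by
    rw [Matrix.det_conjTranspose]
    exact h.star
  have h1 : (offBlock J B μ)ᴴ * offProj J = -(offProj J * offBlock J B μ) := by
    rw [← conjTranspose_offProj J, ← Matrix.conjTranspose_mul, conjTranspose_offProj,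
      offProj_mul_offBlock, Matrix.conjTranspose_mul, Matrix.conjTranspose_mul, hs,
      conjTranspose_offProj, mul_assoc, neg_mul, mul_neg]
  have h2 : ((offBlock J B μ)ᴴ)⁻¹ * ((offBlock J B μ)ᴴ * offProj J) * (offBlock J B μ)⁻¹ =
      -(((offBlock J B μ)ᴴ)⁻¹ * (offProj J * offBlock J B μ) * (offBlock J B μ)⁻¹) := by
    rw [h1]
    simp
  rw [← mul_assoc, Matrix.nonsing_inv_mul _ hu, one_mul, mul_assoc, mul_assoc,
    Matrix.mul_nonsing_inv _ h, mul_one] at h2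
  rw [Matrix.conjTranspose_mul, conjTranspose_offProj, Matrix.conjTranspose_nonsing_inv, h2,
    neg_neg]

theorem schurTerm_eq {J : Finset (Fin n)} {B : Matrix (Fin n) (Fin n) ℂ} {μ : ℂ}
    (h : IsUnit (offBlock J B μ).det) :
    schurTerm J B μ = B * (offProj J * (offBlock J B μ)⁻¹) * B := by
  have : schurTerm J B μ = B * (offProj J * (offBlock J B μ)⁻¹ * offProj J) * B := by
    simp only [schurTerm, mul_assoc]
  rw [this, offProj_mul_inv h, mul_assoc _ (offProj J), offProj_mul_offProj]

theorem conjTranspose_schurTerm {J : Finset (Fin n)} {B : Matrix (Fin n) (Fin n) ℂ} {μ : ℂ}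
    (hB : Bᴴ = -B) (hμ : star μ = -μ) : (schurTerm J B μ)ᴴ = -schurTerm J B μ := by
  by_cases h : IsUnit (offBlock J B μ).det
  · rw [schurTerm_eq h, Matrix.conjTranspose_mul, Matrix.conjTranspose_mul, hB,
      conjTranspose_inv_offBlock hB hμ h]
    simp [mul_assoc]
  · simp [schurTerm, Matrix.nonsing_inv_apply_not_isUnit _ h]

section Derivatives

attribute [local instance] Matrix.frobeniusNormedRing Matrix.frobeniusNormedAlgebra

theorem hasDerivAt_schurTerm {J : Finset (Fin n)} {B : Matrix (Fin n) (Fin n) ℂ} {μ : ℂ} (c : ℂ)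
    (h : IsUnit (offBlock J B μ).det) (i j : Fin n) :
    HasDerivAt (fun t : ℝ => schurTerm J B (μ + t * c) i j)
      (c * (B * (offProj J * (offBlock J B μ)⁻¹) *
        ((offProj J * (offBlock J B μ)⁻¹) * B)) i j) 0 := by
  set N := offBlock J B μ with hN
  set P := offProj J with hP
  have hγ : HasDerivAt (fun t : ℝ => offBlock J B (μ + t * c)) (-(c • P)) 0 := by
    have h1 : (fun t : ℝ => offBlock J B (μ + t * c)) = fun t : ℝ => t • (-(c • P)) + N := by
      ext1 t
      have : B - (μ + t * c) • (1 : Matrix (Fin n) (Fin n) ℂ) = (B - μ • 1) - (t * c) • 1 := by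
        module
      simp only [offBlock, hN, this, ← hP, mul_sub, sub_mul _ _ P, Matrix.mul_smul,
        Matrix.smul_mul, mul_one]
      rw [hP, offProj_mul_offProj, ← hP, mul_smul]
      rw [Complex.coe_smul]
      module
    rw [h1]
    exact (((hasDerivAt_id (0 : ℝ)).smul_const (-(c • P))).add_const N).congr_deriv (one_smul _ _)
  have hu : IsUnit N := (Matrix.isUnit_iff_isUnit_det N).2 h
  have hinv : HasDerivAt (fun t : ℝ => (offBlock J B (μ + t * c))⁻¹) (c • (N⁻¹ * P * N⁻¹)) 0 := by
    have h0 : offBlock J B (μ + (0 : ℝ) * c) = hu.unit := by simp [hN]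
    have h2 := hasFDerivAt_ringInverse (𝕜 := ℝ) hu.unit
    rw [← h0] at h2
    have h3 := h2.comp_hasDerivAt (0 : ℝ) hγ
    have h4 : ((hu.unit⁻¹ : (Matrix (Fin n) (Fin n) ℂ)ˣ) : Matrix (Fin n) (Fin n) ℂ) = N⁻¹ := by
      rw [Matrix.coe_units_inv]
      rfl
    simp only [Matrix.nonsing_inv_eq_ringInverse] at h4 ⊢
    refine h3.congr_deriv ?_
    simp [h4]
  have hS : HasDerivAt (fun t : ℝ => schurTerm J B (μ + t * c))
      (B * P * (c • (N⁻¹ * P * N⁻¹)) * (P * B)) 0 :=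
    (hinv.const_mul (B * P)).mul_const (P * B)
  have hl := (LinearMap.toContinuousLinearMap
    (Matrix.entryLinearMap ℝ ℂ i j)).hasFDerivAt.comp_hasDerivAt (0 : ℝ) hS
  refine hl.congr_deriv ?_
  have : B * P * (c • (N⁻¹ * P * N⁻¹)) * (P * B) = c • (B * (P * N⁻¹) * ((P * N⁻¹) * B)) := by
    have e : P * N⁻¹ = N⁻¹ * P := offProj_mul_inv h
    have e' : P * P = P := offProj_mul_offProj J
    simp only [Matrix.mul_smul, Matrix.smul_mul]
    congr 1
    calc B * P * (N⁻¹ * P * N⁻¹) * (P * B) = B * (P * N⁻¹) * (P * N⁻¹ * P) * B := by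
          simp only [mul_assoc]
      _ = _ := by rw [e, mul_assoc _ P P, e']; simp only [mul_assoc]
  rw [this]
  rfl

/-- The Schur complement is smooth where it is defined. -/
theorem contDiffAt_schurTerm {E : Type*} [NormedAddCommGroup E] [NormedSpace ℝ E]
    {J : Finset (Fin n)} {f : E → Matrix (Fin n) (Fin n) ℂ} {g : E → ℂ} {x : E}
    (hf : ContDiffAt ℝ ∞ f x) (hg : ContDiffAt ℝ ∞ g x)
    (h : IsUnit (offBlock J (f x) (g x)).det) :
    ContDiffAt ℝ ∞ (fun y => schurTerm J (f y) (g y)) x := by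
  have hu := (Matrix.isUnit_iff_isUnit_det _).2 h
  have hb : ContDiffAt ℝ ∞ (fun y => offBlock J (f y) (g y)) x := by
    unfold offBlock
    exact ((contDiffAt_const.mul (hf.sub (hg.smul contDiffAt_const))).mul
      contDiffAt_const).add contDiffAt_const
  have hi : ContDiffAt ℝ ∞ (fun y => (offBlock J (f y) (g y))⁻¹) x := by
    simp only [Matrix.nonsing_inv_eq_ringInverse]
    have := contDiffAt_ringInverse ℝ (n := ∞) hu.unit
    rw [IsUnit.unit_spec] at this
    exact this.comp x hb
  exact ((hf.mul contDiffAt_const).mul hi).mul (contDiffAt_const.mul hf)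

end Derivatives

end SchurComplement

section Eigenspaces

open scoped ComplexOrder

variable {n : ℕ}

theorem offProj_mulVec (J : Finset (Fin n)) (z : Fin n → ℂ) (i : Fin n) :
    (offProj J *ᵥ z) i = if i ∈ J then 0 else z i := by
  simp [offProj, Matrix.mulVec_diagonal]

theorem offBlock_mulVec_of_offProj_mulVec {J : Finset (Fin n)} {A : Matrix (Fin n) (Fin n) ℂ}
    {μ : ℂ} {w : Fin n → ℂ} (hw : offProj J *ᵥ w = w) :
    offBlock J A μ *ᵥ w = offProj J *ᵥ (A *ᵥ w) - μ • w := by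
  rw [offBlock, Matrix.add_mulVec, ← Matrix.mulVec_mulVec, ← Matrix.mulVec_mulVec,
    Matrix.sub_mulVec, Matrix.sub_mulVec, Matrix.one_mulVec, hw, Matrix.smul_mulVec,
    Matrix.one_mulVec, Matrix.mulVec_sub, Matrix.mulVec_smul, hw, sub_self, add_zero]

theorem isUnit_det_offBlock {A : Matrix (Fin n) (Fin n) ℂ} {μ : ℂ} {J : Finset (Fin n)}
    (hA : Aᴴ = -A) (hμ : star μ = -μ)
    (hsurj : ∀ y : Fin n → ℂ, ∃ z, A *ᵥ z = μ • z ∧ ∀ j ∈ J, z j = y j)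
    (hinj : ∀ z, A *ᵥ z = μ • z → (∀ j ∈ J, z j = 0) → z = 0) :
    IsUnit (offBlock J A μ).det := by
  rw [isUnit_iff_ne_zero]
  intro h0
  obtain ⟨x, hx0, hx⟩ := Matrix.exists_mulVec_eq_zero_iff.2 h0
  have h1 : offProj J *ᵥ ((A - μ • 1) *ᵥ (offProj J *ᵥ x)) = 0 := by
    rw [Matrix.mulVec_mulVec, Matrix.mulVec_mulVec, ← offProj_mul_offBlock,
      ← Matrix.mulVec_mulVec, hx, Matrix.mulVec_zero]
  have h2 : offProj J *ᵥ x = x := by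
    rw [offBlock, Matrix.add_mulVec, ← Matrix.mulVec_mulVec, ← Matrix.mulVec_mulVec, h1, zero_add,
      Matrix.sub_mulVec, Matrix.one_mulVec, sub_eq_zero] at hx
    exact hx.symm
  rw [h2] at h1
  have hxJ : ∀ j ∈ J, x j = 0 := fun j hj => by
    rw [← h2, offProj_mulVec, if_pos hj]
  set y := (A - μ • 1) *ᵥ x with hy
  have hyJ : ∀ j ∉ J, y j = 0 := fun j hj => by
    simpa [offProj_mulVec, hj] using congrFun h1 j
  obtain ⟨z, hz, hzy⟩ := hsurj y
  have h3 : star z ⬝ᵥ y = star y ⬝ᵥ y := by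
    refine Finset.sum_congr rfl fun j _ => ?_
    by_cases hj : j ∈ J
    · simp [hzy j hj]
    · simp [hyJ j hj]
  have h4 : star z ⬝ᵥ y = 0 := by
    have : star z ᵥ* A = μ • star z := by
      rw [← Matrix.conjTranspose_conjTranspose A, ← Matrix.star_mulVec, hA, Matrix.neg_mulVec, hz,
        star_neg, star_smul, hμ, neg_smul, neg_neg]
    rw [hy, Matrix.sub_mulVec, dotProduct_sub, Matrix.dotProduct_mulVec, this,
      Matrix.smul_mulVec, Matrix.one_mulVec, dotProduct_smul, smul_dotProduct, sub_self]
  have hy0 : y = 0 := dotProduct_star_self_eq_zero.1 (h3 ▸ h4)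
  refine hx0 (hinj x ?_ hxJ)
  rwa [hy, Matrix.sub_mulVec, Matrix.smul_mulVec, Matrix.one_mulVec, sub_eq_zero] at hy0

/-- The Schur complement vanishes if the eigenvectors have arbitrary coordinates in `J`. -/
theorem apply_eq_add_schurTerm {A : Matrix (Fin n) (Fin n) ℂ} {μ : ℂ} {J : Finset (Fin n)}
    (hdet : IsUnit (offBlock J A μ).det)
    (hsurj : ∀ y : Fin n → ℂ, ∃ z, A *ᵥ z = μ • z ∧ ∀ j ∈ J, z j = y j)
    {a b : Fin n} (ha : a ∈ J) (hb : b ∈ J) :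
    A a b = (if a = b then μ else 0) + schurTerm J A μ a b := by
  obtain ⟨z, hz, hzb⟩ := hsurj (Pi.single b 1)
  set w := offProj J *ᵥ z with hw
  have hPw : offProj J *ᵥ w = w := by
    rw [hw, Matrix.mulVec_mulVec, offProj_mul_offProj]
  have hzw : z = Pi.single b 1 + w := by
    ext j
    rw [Pi.add_apply, hw, offProj_mulVec]
    by_cases hj : j ∈ J
    · simp [hj, hzb j hj]
    · simp [hj, show j ≠ b from fun h => hj (h ▸ hb)]
  have hM : offBlock J A μ *ᵥ w = -((offProj J * A) *ᵥ Pi.single b 1) := by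
    have h := congrArg (offProj J *ᵥ ·) hz
    simp only [Matrix.mulVec_smul] at h
    rw [← hw] at h
    rw [offBlock_mulVec_of_offProj_mulVec hPw, ← h, hzw, Matrix.mulVec_add, Matrix.mulVec_add,
      Matrix.mulVec_mulVec (Pi.single b 1)]
    abel
  have hw' : w = -((offBlock J A μ)⁻¹ *ᵥ ((offProj J * A) *ᵥ Pi.single b 1)) := by
    rw [← Matrix.mulVec_neg, ← hM, Matrix.mulVec_mulVec, Matrix.nonsing_inv_mul _ hdet,
      Matrix.one_mulVec]
  have hAw : A *ᵥ w = -(schurTerm J A μ *ᵥ Pi.single b 1) := by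
    rw [← hPw, hw', schurTerm]
    simp only [Matrix.mulVec_neg, Matrix.mulVec_mulVec, mul_assoc]
  have := congrFun hz a
  rw [hzw, Matrix.mulVec_add, hAw, ← hzw] at this
  simp only [Pi.add_apply, Pi.neg_apply, Matrix.mulVec_single_one, Matrix.col_apply,
    Pi.smul_apply, hzb a ha, Pi.single_apply, smul_eq_mul, mul_ite, mul_one, mul_zero] at this
  linear_combination this

/-- If a column of the Schur complement vanishes, there is a corresponding eigenvector. -/
theorem exists_eigenvector_of_schurTerm {A : Matrix (Fin n) (Fin n) ℂ} {μ : ℂ}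
    {J : Finset (Fin n)} (hdet : IsUnit (offBlock J A μ).det) {b : Fin n} (hb : b ∈ J)
    (h : ∀ a ∈ J, A a b = (if a = b then μ else 0) + schurTerm J A μ a b) :
    ∃ z, A *ᵥ z = μ • z ∧ ∀ j ∈ J, z j = if j = b then 1 else 0 := by
  set w := -((offBlock J A μ)⁻¹ *ᵥ ((offProj J * A) *ᵥ Pi.single b 1)) with hw
  have hPw : offProj J *ᵥ w = w := by
    rw [hw, Matrix.mulVec_neg, Matrix.mulVec_mulVec, offProj_mul_inv hdet, Matrix.mulVec_mulVec,
      Matrix.mulVec_mulVec, mul_assoc, ← mul_assoc (offProj J), offProj_mul_offProj]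
  have hM : offBlock J A μ *ᵥ w = -((offProj J * A) *ᵥ Pi.single b 1) := by
    rw [hw, Matrix.mulVec_neg, Matrix.mulVec_mulVec, Matrix.mul_nonsing_inv _ hdet,
      Matrix.one_mulVec]
  have hAw : A *ᵥ w = -(schurTerm J A μ *ᵥ Pi.single b 1) := by
    rw [← hPw, hw, schurTerm]
    simp only [Matrix.mulVec_neg, Matrix.mulVec_mulVec, mul_assoc]
  have hwJ : ∀ j ∈ J, w j = 0 := fun j hj => by rw [← hPw, offProj_mulVec, if_pos hj]
  refine ⟨Pi.single b 1 + w, ?_, fun j hj => by simp [hwJ j hj, Pi.single_apply]⟩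
  ext a
  by_cases ha : a ∈ J
  · rw [Matrix.mulVec_add, hAw]
    simp only [Pi.add_apply, Pi.neg_apply, Matrix.mulVec_single_one, Matrix.col_apply,
      Pi.smul_apply, hwJ a ha, Pi.single_apply, smul_eq_mul, h a ha]
    simp
  · rw [offBlock_mulVec_of_offProj_mulVec hPw] at hM
    have := congrFun hM a
    rw [← Matrix.mulVec_mulVec] at this
    simp only [Pi.sub_apply, Pi.neg_apply, offProj_mulVec, if_neg ha, Pi.smul_apply] at this
    rw [Matrix.mulVec_add]
    simp only [Pi.add_apply, Pi.smul_apply, smul_add, Pi.single_apply,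
      if_neg (show a ≠ b from fun h => ha (h ▸ hb)), smul_zero]
    linear_combination this

theorem mem_eigenspace_toLin' {A : Matrix (Fin n) (Fin n) ℂ} {μ : ℂ} {z : Fin n → ℂ} :
    z ∈ Module.End.eigenspace (Matrix.toLin' A) μ ↔ A *ᵥ z = μ • z := by
  rw [Module.End.mem_eigenspace_iff, Matrix.toLin'_apply]

theorem exists_ne_zero_of_one_lt_finrank {E : Submodule ℂ (Fin n → ℂ)}
    (hE : 1 < Module.finrank ℂ E) (i : Fin n) : ∃ z ∈ E, z ≠ 0 ∧ z i = 0 := by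
  have h := LinearMap.ker_ne_bot_of_finrank_lt
    (f := (LinearMap.proj i : (Fin n → ℂ) →ₗ[ℂ] ℂ) ∘ₗ E.subtype) (by simpa using hE)
  obtain ⟨z, hz, hz0⟩ := Submodule.exists_mem_ne_zero_of_ne_bot h
  exact ⟨z, z.2, fun h => hz0 (Subtype.ext h), hz⟩

theorem isDerogatory_of_eigenvectors {A : Matrix (Fin n) (Fin n) ℂ} {μ : ℂ} {p q : Fin n}
    {u v : Fin n → ℂ} (hu : A *ᵥ u = μ • u) (hv : A *ᵥ v = μ • v) (hup : u p ≠ 0)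
    (hvp : v p = 0) (hvq : v q ≠ 0) : IsDerogatory A := by
  refine ⟨μ, ?_⟩
  have h : LinearIndependent ℂ ![(⟨u, mem_eigenspace_toLin'.2 hu⟩ :
      Module.End.eigenspace (Matrix.toLin' A) μ), ⟨v, mem_eigenspace_toLin'.2 hv⟩] := by
    rw [LinearIndependent.pair_iff]
    intro s t hst
    have hst : ∀ i, s * u i + t * v i = 0 := fun i => congrFun (congrArg Subtype.val hst) i
    have hs : s = 0 := by simpa [hvp, hup] using hst p
    exact ⟨hs, by simpa [hs, hvq] using hst q⟩
  exact lt_of_lt_of_le (by simp) h.fintype_card_le_finrank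

theorem star_eq_neg_of_eigenvector {A : Matrix (Fin n) (Fin n) ℂ} (hA : Aᴴ = -A) {μ : ℂ}
    {z : Fin n → ℂ} (hz : A *ᵥ z = μ • z) (hz0 : z ≠ 0) : star μ = -μ := by
  have h : star z ᵥ* A = (-star μ) • star z := by
    rw [← Matrix.conjTranspose_conjTranspose A, ← Matrix.star_mulVec, hA, Matrix.neg_mulVec, hz,
      star_neg, star_smul, neg_smul]
  have h1 : (-star μ) * (star z ⬝ᵥ z) = μ * (star z ⬝ᵥ z) := by
    rw [← smul_eq_mul, ← smul_dotProduct, ← h, ← Matrix.dotProduct_mulVec, hz, dotProduct_smul,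
      smul_eq_mul]
  have h2 : star z ⬝ᵥ z ≠ 0 := fun h => hz0 (dotProduct_star_self_eq_zero.1 h)
  exact neg_eq_iff_eq_neg.1 (mul_right_cancel₀ h2 h1)

/-- Pivot indices of a space of dimension at least two. -/
theorem exists_pivots {E : Submodule ℂ (Fin n → ℂ)} (hE : 1 < Module.finrank ℂ E) :
    ∃ p q : Fin n, p < q ∧ ∃ u ∈ E, ∃ v ∈ E, u p ≠ 0 ∧ v p = 0 ∧ v q ≠ 0 ∧ ∀ j < q, v j = 0 := by
  have hex : ∀ z : Fin n → ℂ, z ≠ 0 → ∃ i, z i ≠ 0 := fun z hz => Function.ne_iff.1 hz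
  have hne : ∃ p, ∃ u ∈ E, u p ≠ 0 := by
    have : E ≠ ⊥ := by
      rintro rfl
      simp at hE
    obtain ⟨u, hu, hu0⟩ := Submodule.exists_mem_ne_zero_of_ne_bot this
    obtain ⟨p, hp⟩ := hex u hu0
    exact ⟨p, u, hu, hp⟩
  obtain ⟨p, ⟨u, hu, hup⟩, hpmin⟩ := wellFounded_lt.has_min {p | ∃ u ∈ E, u p ≠ 0} hne
  obtain ⟨v, hv, hv0, hvp⟩ := exists_ne_zero_of_one_lt_finrank hE p
  obtain ⟨q, hq, hqmin⟩ := wellFounded_lt.has_min {q | v q ≠ 0} (hex v hv0)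
  refine ⟨p, q, lt_of_le_of_ne (not_lt.1 (hpmin q ⟨v, hv, hq⟩)) ?_, u, hu, v, hv, hup, hvp, hq,
    fun j hj => not_not.1 fun h => hqmin j h hj⟩
  rintro rfl
  exact hq hvp

/-- Coordinates which are independent on `E` extend to a system of coordinates of `E`. -/
theorem exists_coordinates (E : Submodule ℂ (Fin n → ℂ)) {J₀ : Finset (Fin n)}
    (h : ∀ y : Fin n → ℂ, ∃ z ∈ E, ∀ j ∈ J₀, z j = y j) :
    ∃ J, J₀ ⊆ J ∧ (∀ y : Fin n → ℂ, ∃ z ∈ E, ∀ j ∈ J, z j = y j) ∧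
      ∀ z ∈ E, (∀ j ∈ J, z j = 0) → z = 0 := by
  obtain ⟨J, hJ, hmax⟩ := Finite.exists_le_maximal
    (p := fun J : Finset (Fin n) => ∀ y : Fin n → ℂ, ∃ z ∈ E, ∀ j ∈ J, z j = y j) h
  refine ⟨J, hJ, hmax.1, fun x hx hxJ => ?_⟩
  by_contra hx0
  obtain ⟨i, hi⟩ := Function.ne_iff.1 hx0
  have hiJ : i ∉ J := fun h => hi (hxJ i h)
  refine hiJ (hmax.2 (y := insert i J) (fun y => ?_) (Finset.subset_insert i J)
    (Finset.mem_insert_self i J))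
  obtain ⟨z, hz, hzy⟩ := hmax.1 y
  refine ⟨z + ((y i - z i) / x i) • x, E.add_mem hz (E.smul_mem _ hx), fun j hj => ?_⟩
  rcases Finset.mem_insert.1 hj with rfl | hj
  · have : x j ≠ 0 := hi
    simp [this]
  · simp [hxJ j hj, hzy j hj]

end Eigenspaces

section SchurShift

variable {n k : ℕ}

theorem star_apply_of_skewHermitian {A : Matrix (Fin n) (Fin n) ℂ} (hA : Aᴴ = -A) (i j : Fin n) :
    star (A i j) = -A j i := by
  rw [← Matrix.conjTranspose_apply, hA, Matrix.neg_apply]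

theorem skewHermitian_of_star_apply {A : Matrix (Fin n) (Fin n) ℂ}
    (hA : ∀ i j, star (A i j) = -A j i) : Aᴴ = -A := by
  ext i j
  rw [Matrix.conjTranspose_apply, hA, Matrix.neg_apply]

/-- The correction added to `B` by `schurShift`. -/
noncomputable def schurCorrection (k : ℕ) (J : Finset (Fin n)) (p q : Fin n)
    (B : Matrix (Fin n) (Fin n) ℂ) : Matrix (Fin n) (Fin n) ℂ := fun i j =>
  (if (i = p ∨ i = q) ∧ (j = p ∨ j = q) ∧ |(j : ℤ) - (i : ℤ)| ≤ k then
    schurTerm J B (B p p) i j else 0) + if i = q ∧ j = q then B p p else 0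

theorem schurCorrection_mem (J : Finset (Fin n)) (p q : Fin n) (B : skewHermitianBanded n k) :
    schurCorrection k J p q B ∈ skewHermitianBanded n k := by
  have hB := star_apply_of_skewHermitian B.2.1
  have hS := star_apply_of_skewHermitian (conjTranspose_schurTerm (J := J) B.2.1 (hB p p))
  constructor
  · refine skewHermitian_of_star_apply fun i j => ?_
    simp only [schurCorrection, star_add, neg_add, apply_ite star, star_zero, hB, hS,
      apply_ite (Neg.neg : ℂ → ℂ), neg_zero, abs_sub_comm (j : ℤ) (i : ℤ)]
    congr 1
    · exact if_congr (by tauto) rfl rfl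
    · exact if_congr (by tauto) rfl rfl
  · intro i j hij
    have h1 : ¬ (i = q ∧ j = q) := by
      rintro ⟨rfl, rfl⟩
      simp at hij
      omega
    simp [schurCorrection, not_le.2 hij, h1]

/-- The map which parametrizes the matrices with a multiple eigenvalue: the `p`-th diagonal entry
of the argument is the eigenvalue of the value, and the entries of the argument at `(q, q)` and
`(p, q)` are the obstructions to its multiplicity. -/
noncomputable def schurShift (k : ℕ) (J : Finset (Fin n)) (p q : Fin n)
    (B : skewHermitianBanded n k) : skewHermitianBanded n k :=
  B + ⟨schurCorrection k J p q B, schurCorrection_mem J p q B⟩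

theorem schurShift_apply (J : Finset (Fin n)) (p q : Fin n) (B : skewHermitianBanded n k)
    (i j : Fin n) : (schurShift k J p q B : Matrix (Fin n) (Fin n) ℂ) i j =
      (B : Matrix (Fin n) (Fin n) ℂ) i j + schurCorrection k J p q B i j := rfl

/-- The domain on which the Schur complement in `schurShift` is defined. -/
def schurDomain (k : ℕ) (J : Finset (Fin n)) (p : Fin n) : Set (skewHermitianBanded n k) :=
  {B | IsUnit (offBlock J B ((B : Matrix (Fin n) (Fin n) ℂ) p p)).det}

theorem isOpen_schurDomain (J : Finset (Fin n)) (p : Fin n) : IsOpen (schurDomain k J p) := by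
  have h : Continuous fun B : skewHermitianBanded n k =>
      (offBlock J B ((B : Matrix (Fin n) (Fin n) ℂ) p p)).det := by
    refine Continuous.matrix_det ?_
    have h0 : Continuous fun B : skewHermitianBanded n k => (B : Matrix (Fin n) (Fin n) ℂ) :=
      continuous_subtype_val
    have h1 := h0.matrix_elem p p
    exact ((continuous_const.matrix_mul (h0.sub (h1.smul continuous_const))).matrix_mul
      continuous_const).add continuous_const
  have : schurDomain k J p = (fun B : skewHermitianBanded n k =>
      (offBlock J B ((B : Matrix (Fin n) (Fin n) ℂ) p p)).det) ⁻¹' {0}ᶜ := by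
    ext B
    simp [schurDomain, isUnit_iff_ne_zero]
  rw [this]
  exact isOpen_compl_singleton.preimage h

theorem contDiffAt_matrix {E : Type*} [NormedAddCommGroup E] [NormedSpace ℝ E]
    {f : E → Matrix (Fin n) (Fin n) ℂ} {x : E}
    (h : ∀ i j, ContDiffAt ℝ ∞ (fun y => f y i j) x) : ContDiffAt ℝ ∞ f x :=
  ((Matrix.ofLinearEquiv (m := Fin n) (n := Fin n) (α := ℂ) ℝ).toLinearMap.toContinuousLinearMap
    |>.contDiff.contDiffAt).comp (f := fun y i j => f y i j) x
    (contDiffAt_pi.2 fun i => contDiffAt_pi.2 fun j => h i j)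

theorem contDiffAt_subtype {E V : Type*} [NormedAddCommGroup E] [NormedSpace ℝ E]
    [NormedAddCommGroup V] [NormedSpace ℝ V] [FiniteDimensional ℝ V] {W : Submodule ℝ V}
    {f : E → W} {x : E} (h : ContDiffAt ℝ ∞ (fun y => (f y : V)) x) : ContDiffAt ℝ ∞ f x := by
  obtain ⟨g, hg⟩ := W.subtype.exists_leftInverse_of_injective W.ker_subtype
  have : f = fun y => LinearMap.toContinuousLinearMap g (f y : V) := by
    ext1 y
    exact (LinearMap.congr_fun hg (f y)).symm
  rw [this]
  exact g.toContinuousLinearMap.contDiff.contDiffAt.comp x h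

/-- The entries of a matrix, as continuous linear functionals. -/
noncomputable def entryCLM (k : ℕ) (i j : Fin n) : skewHermitianBanded n k →L[ℝ] ℂ :=
  LinearMap.toContinuousLinearMap
    ((Matrix.entryLinearMap ℝ ℂ i j) ∘ₗ (skewHermitianBanded n k).subtype)

theorem contDiffAt_schurShift {J : Finset (Fin n)} {p : Fin n} (q : Fin n)
    {B : skewHermitianBanded n k} (hB : B ∈ schurDomain k J p) :
    ContDiffAt ℝ ∞ (schurShift k J p q) B := by
  refine contDiffAt_subtype (contDiffAt_matrix fun i j => ?_)
  have hentry : ∀ i j, ContDiffAt ℝ ∞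
      (fun X : skewHermitianBanded n k => (X : Matrix (Fin n) (Fin n) ℂ) i j) B :=
    fun i j => (entryCLM k i j).contDiff.contDiffAt
  have hS := contDiffAt_schurTerm (J := J)
    ((skewHermitianBanded n k).subtypeL.contDiff.contDiffAt (x := B)) (hentry p p) hB
  have hSij : ContDiffAt ℝ ∞ (fun X : skewHermitianBanded n k =>
      schurTerm J X ((X : Matrix (Fin n) (Fin n) ℂ) p p) i j) B :=
    (Matrix.entryLinearMap ℝ ℂ i j).toContinuousLinearMap.contDiff.contDiffAt.comp B hS
  simp only [schurShift_apply, schurCorrection]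
  refine (hentry i j).add (ContDiffAt.add ?_ ?_)
  · split_ifs
    · exact hSij
    · exact contDiffAt_const
  · split_ifs
    · exact hentry p p
    · exact contDiffAt_const

theorem offProj_mul_eq_zero {J : Finset (Fin n)} {H : Matrix (Fin n) (Fin n) ℂ}
    (h : ∀ i ∉ J, ∀ j, H i j = 0) : offProj J * H = 0 := by
  ext i j
  rw [offProj, Matrix.diagonal_mul]
  by_cases hi : i ∈ J
  · simp [hi]
  · simp [h i hi j]

theorem mul_offProj_eq_zero {J : Finset (Fin n)} {H : Matrix (Fin n) (Fin n) ℂ}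
    (h : ∀ j ∉ J, ∀ i, H i j = 0) : H * offProj J = 0 := by
  ext i j
  rw [offProj, Matrix.mul_diagonal]
  by_cases hj : j ∈ J
  · simp [hj]
  · simp [h j hj i]

theorem schurTerm_congr_of_eq_off {J : Finset (Fin n)} {p q : Fin n} (hp : p ∈ J) (hq : q ∈ J)
    {B B' : Matrix (Fin n) (Fin n) ℂ}
    (h : ∀ i j, ¬((i = p ∨ i = q) ∧ (j = p ∨ j = q)) → B i j = B' i j) (μ : ℂ) :
    schurTerm J B μ = schurTerm J B' μ ∧ offBlock J B μ = offBlock J B' μ := by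
  have hpq : ∀ i ∉ J, ¬(i = p ∨ i = q) := by
    rintro i hi (rfl | rfl)
    exacts [hi hp, hi hq]
  have h1 : offProj J * B = offProj J * B' := by
    rw [← sub_eq_zero, ← mul_sub]
    exact offProj_mul_eq_zero fun i hi j => sub_eq_zero.2 (h i j fun h => hpq i hi h.1)
  have h2 : B * offProj J = B' * offProj J := by
    rw [← sub_eq_zero, ← sub_mul]
    exact mul_offProj_eq_zero fun j hj i => sub_eq_zero.2 (h i j fun h => hpq j hj h.2)
  exact ⟨schurTerm_congr h1 h2 μ, offBlock_congr h1 μ⟩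

/-- The differential of `schurShift` is injective. -/
theorem fderiv_schurShift_injective {J : Finset (Fin n)} {p q : Fin n} (hp : p ∈ J) (hq : q ∈ J)
    (hpq : p ≠ q) {B : skewHermitianBanded n k} (hB : B ∈ schurDomain k J p)
    (H : skewHermitianBanded n k) (hH : fderiv ℝ (schurShift k J p q) B H = 0) : H = 0 := by
  set b := (B : Matrix (Fin n) (Fin n) ℂ) with hb
  set h := (H : Matrix (Fin n) (Fin n) ℂ) with hh
  have hline : ∀ i j, HasDerivAt (fun t : ℝ =>
      (b i j + t * h i j) + schurCorrection k J p q (b + (t : ℂ) • h) i j) 0 0 := by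
    intro i j
    have h1 : HasFDerivAt (schurShift k J p q) (fderiv ℝ (schurShift k J p q) B)
        (B + (0 : ℝ) • H) := by
      rw [zero_smul, add_zero]
      exact ((contDiffAt_schurShift q hB).differentiableAt (by simp)).hasFDerivAt
    have h2 : HasDerivAt (fun t : ℝ => B + t • H) H 0 :=
      (((hasDerivAt_id (0 : ℝ)).smul_const H).const_add B).congr_deriv (one_smul _ _)
    have h3 := (entryCLM k i j).hasFDerivAt.comp_hasDerivAt (0 : ℝ) (h1.comp_hasDerivAt (0 : ℝ) h2)
    exact h3.congr_deriv ((congrArg (entryCLM k i j) hH).trans (map_zero _))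
  have haff : ∀ (x y c : ℂ), HasDerivAt (fun t : ℝ => (x + t * y) + c) y 0 := by
    intro x y c
    have := ((((hasDerivAt_id (0 : ℝ)).ofReal_comp).mul_const y).const_add x).add_const c
    simpa using this
  have hsupp : ∀ i j, ¬((i = p ∨ i = q) ∧ (j = p ∨ j = q)) → h i j = 0 := by
    intro i j hij
    have h1 := hline i j
    have h2 : ∀ X, schurCorrection k J p q X i j = 0 := by
      intro X
      rw [schurCorrection, if_neg (by tauto), if_neg (by tauto), add_zero]
    simp only [h2] at h1
    exact (haff _ _ 0).unique h1
  have hcongr : ∀ (t : ℝ) μ, schurTerm J (b + (t : ℂ) • h) μ = schurTerm J b μ := fun t μ =>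
    (schurTerm_congr_of_eq_off hp hq (fun i j hij => by simp [hsupp i j hij]) μ).1
  have hpp : h p p = 0 := by
    have h1 := hline p p
    have h2 : ∀ t : ℝ, schurCorrection k J p q (b + (t : ℂ) • h) p p =
        schurTerm J b (b p p + t * h p p) p p := by
      intro t
      rw [schurCorrection, if_pos (by simp), if_neg (by tauto), add_zero, hcongr]
      rfl
    simp only [h2] at h1
    have h3 := (by simpa using haff (b p p) (h p p) 0 :
      HasDerivAt (fun t : ℝ => b p p + t * h p p) (h p p) 0).add
        (hasDerivAt_schurTerm (h p p) hB p p)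
    have h4 := h3.unique h1
    set R := offProj J * (offBlock J b (b p p))⁻¹ with hR
    have hRs : Rᴴ = -R :=
      conjTranspose_inv_offBlock B.2.1 (star_apply_of_skewHermitian B.2.1 p p) hB
    have h5 : R * b = (b * R)ᴴ := by
      rw [Matrix.conjTranspose_mul, hRs, show bᴴ = -b from B.2.1, neg_mul_neg]
    rw [h5, Matrix.mul_apply] at h4
    have h6 : ∑ j, (b * R) p j * (b * R)ᴴ j p = ((∑ j, Complex.normSq ((b * R) p j) : ℝ) : ℂ) := by
      rw [Complex.ofReal_sum]
      exact Finset.sum_congr rfl fun j _ => by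
        rw [Matrix.conjTranspose_apply]
        exact Complex.mul_conj _
    rw [h6] at h4
    have h7 : h p p * ((1 + ∑ j, Complex.normSq ((b * R) p j) : ℝ) : ℂ) = 0 := by
      rw [← h4]
      push_cast
      ring
    have h8 : (0 : ℝ) < 1 + ∑ j, Complex.normSq ((b * R) p j) := by
      have := Finset.sum_nonneg fun j (_ : j ∈ Finset.univ) => Complex.normSq_nonneg ((b * R) p j)
      linarith
    exact (mul_eq_zero.1 h7).resolve_right (Complex.ofReal_ne_zero.2 h8.ne')
  refine Subtype.ext (Matrix.ext fun i j => ?_)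
  have h1 := hline i j
  have h2 : ∀ t : ℝ, schurCorrection k J p q (b + (t : ℂ) • h) i j =
      schurCorrection k J p q b i j := by
    intro t
    have : (b + (t : ℂ) • h) p p = b p p := by simp [hpp]
    simp only [schurCorrection, this, hcongr]
  simp only [h2] at h1
  exact (haff _ _ _).unique h1

/-- The conditions on the argument of `schurShift` for a multiple eigenvalue. -/
noncomputable def pinnedMap (k : ℕ) (q r s : Fin n) : skewHermitianBanded n k →ₗ[ℝ] ℝ × ℂ :=
  (Complex.imLm ∘ₗ (entryCLM k q q).toLinearMap).prod (entryCLM k r s).toLinearMap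

theorem mem_ker_pinnedMap {q r s : Fin n} {B : skewHermitianBanded n k} :
    B ∈ LinearMap.ker (pinnedMap k q r s) ↔
      (B : Matrix (Fin n) (Fin n) ℂ) q q = 0 ∧ (B : Matrix (Fin n) (Fin n) ℂ) r s = 0 := by
  have h := congrArg Complex.re (star_apply_of_skewHermitian B.2.1 q q)
  simp only [Complex.star_def, Complex.conj_re, Complex.neg_re] at h
  change (((B : Matrix (Fin n) (Fin n) ℂ) q q).im, (B : Matrix (Fin n) (Fin n) ℂ) r s) = (0, 0) ↔ _
  rw [Prod.mk.injEq, Complex.ext_iff (z := (B : Matrix (Fin n) (Fin n) ℂ) q q)]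
  constructor
  · rintro ⟨h1, h2⟩
    exact ⟨⟨by rw [Complex.zero_re]; linarith, h1⟩, h2⟩
  · rintro ⟨h1, h2⟩
    exact ⟨h1.2, h2⟩

theorem finrank_ker_pinnedMap {q r s : Fin n} (hrs : r ≠ s) (hk : |(s : ℤ) - (r : ℤ)| ≤ k) :
    Module.finrank ℝ (skewHermitianBanded n k) =
      Module.finrank ℝ (LinearMap.ker (pinnedMap k q r s)) + 3 := by
  have hsurj : LinearMap.range (pinnedMap k q r s) = ⊤ := by
    rw [LinearMap.range_eq_top]
    rintro ⟨x, z⟩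
    let X : Matrix (Fin n) (Fin n) ℂ := fun i j => (if i = q ∧ j = q then x * Complex.I else 0) +
      ((if i = r ∧ j = s then z else 0) + if i = s ∧ j = r then -star z else 0)
    have hX : X ∈ skewHermitianBanded n k := by
      constructor
      · refine skewHermitian_of_star_apply fun i j => ?_
        simp only [X, star_add, neg_add, apply_ite star, star_zero, star_neg, star_star,
          apply_ite (Neg.neg : ℂ → ℂ), neg_zero, neg_neg]
        rw [add_comm (ite (i = r ∧ j = s) _ _)]
        congr 1
        · exact if_congr (by tauto) (by simp) rfl
        · congr 1
          · exact if_congr (by tauto) rfl rfl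
          · exact if_congr (by tauto) rfl rfl
      · intro i j hij
        have h1 : ¬ (i = q ∧ j = q) := by
          rintro ⟨rfl, rfl⟩
          simp at hij
          omega
        have h2 : ¬ (i = r ∧ j = s) := by
          rintro ⟨rfl, rfl⟩
          omega
        have h3 : ¬ (i = s ∧ j = r) := by
          rintro ⟨rfl, rfl⟩
          rw [abs_sub_comm] at hij
          omega
        simp [X, h1, h2, h3]
    refine ⟨⟨X, hX⟩, Prod.ext ?_ ?_⟩
    · have h2 : ¬ (q = r ∧ q = s) := fun h => hrs (h.1.symm.trans h.2)
      have h3 : ¬ (q = s ∧ q = r) := fun h => hrs (h.2.symm.trans h.1)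
      change (X q q).im = x
      simp [X, h2, h3]
    · have h2 : ¬ (r = q ∧ s = q) := fun h => hrs (h.1.trans h.2.symm)
      have h3 : ¬ (r = s ∧ s = r) := fun h => hrs h.1
      change X r s = z
      simp only [X, h2, h3]
      simp
  have h := LinearMap.finrank_range_add_finrank_ker (pinnedMap k q r s)
  rw [hsurj, finrank_top, Module.finrank_prod, Module.finrank_self, Complex.finrank_real_complex]
    at h
  omega

/-- The matrix `A` with its entries in the rows and columns `p`, `q` replaced by `t i` (at `(p, p)`)
and zeros. -/
noncomputable def pinned (p q : Fin n) (A : skewHermitianBanded n k) (t : ℝ) :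
    skewHermitianBanded n k :=
  ⟨fun i j => if (i = p ∨ i = q) ∧ (j = p ∨ j = q) then
      if i = p ∧ j = p then t * Complex.I else 0
    else (A : Matrix (Fin n) (Fin n) ℂ) i j, by
    have hA := star_apply_of_skewHermitian A.2.1
    constructor
    · refine skewHermitian_of_star_apply fun i j => ?_
      simp only [apply_ite star, star_zero, hA, apply_ite (Neg.neg : ℂ → ℂ), neg_zero]
      exact if_congr (by tauto) (if_congr (by tauto) (by simp) rfl) rfl
    · intro i j hij
      have h1 : ¬ (i = p ∧ j = p) := by
        rintro ⟨rfl, rfl⟩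
        simp at hij
        omega
      simp [h1, A.2.2 i j hij]⟩

theorem pinned_apply (p q : Fin n) (A : skewHermitianBanded n k) (t : ℝ) (i j : Fin n) :
    (pinned p q A t : Matrix (Fin n) (Fin n) ℂ) i j =
      if (i = p ∨ i = q) ∧ (j = p ∨ j = q) then if i = p ∧ j = p then t * Complex.I else 0
      else (A : Matrix (Fin n) (Fin n) ℂ) i j := rfl

theorem continuous_pinned (p q : Fin n) :
    Continuous fun x : skewHermitianBanded n k × ℝ => pinned p q x.1 x.2 := by
  refine Continuous.subtype_mk (continuous_matrix fun i j => ?_) _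
  have h := ((entryCLM k i j).continuous.comp continuous_fst :
    Continuous fun x : skewHermitianBanded n k × ℝ => entryCLM k i j x.1)
  split_ifs
  · fun_prop
  · fun_prop
  · exact h

/-- A matrix with a multiple eigenvalue is a value of `schurShift`. -/
theorem schurShift_pinned {J : Finset (Fin n)} {p q : Fin n} (hp : p ∈ J) (hq : q ∈ J)
    (hpq : p ≠ q) {A : skewHermitianBanded n k} {t : ℝ}
    (hdet : IsUnit (offBlock J A (t * Complex.I)).det)
    (h : ∀ a ∈ J, ∀ b ∈ J, (A : Matrix (Fin n) (Fin n) ℂ) a b =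
      (if a = b then t * Complex.I else 0) + schurTerm J A (t * Complex.I) a b) :
    pinned p q A t ∈ schurDomain k J p ∧ schurShift k J p q (pinned p q A t) = A := by
  have hpp : (pinned p q A t : Matrix (Fin n) (Fin n) ℂ) p p = t * Complex.I := by
    simp [pinned_apply]
  have hc := schurTerm_congr_of_eq_off hp hq
    (B := (pinned p q A t : Matrix (Fin n) (Fin n) ℂ)) (B' := A)
    (fun i j hij => by rw [pinned_apply, if_neg hij]) (t * Complex.I)
  constructor
  · rw [schurDomain, Set.mem_ofPred_eq, hpp, hc.2]
    exact hdet
  · refine Subtype.ext (Matrix.ext fun i j => ?_)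
    rw [schurShift_apply, schurCorrection, hpp, hc.1, pinned_apply]
    by_cases hij : (i = p ∨ i = q) ∧ (j = p ∨ j = q)
    · by_cases hband : |(j : ℤ) - (i : ℤ)| ≤ k
      · have hi : i ∈ J := by rcases hij.1 with rfl | rfl <;> assumption
        have hj : j ∈ J := by rcases hij.2 with rfl | rfl <;> assumption
        have hij' : (i = p ∨ i = q) ∧ (j = p ∨ j = q) ∧ |(j : ℤ) - (i : ℤ)| ≤ k :=
          ⟨hij.1, hij.2, hband⟩
        rw [if_pos hij, if_pos hij', h i hi j hj]
        clear hij' hc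
        rcases hij with ⟨rfl | rfl, rfl | rfl⟩ <;> simp [hpq, hpq.symm, add_comm]
      · have hne : ∀ a, ¬(i = a ∧ j = a) := by
          rintro a ⟨rfl, rfl⟩
          simp at hband
        have hij' : ¬((i = p ∨ i = q) ∧ (j = p ∨ j = q) ∧ |(j : ℤ) - (i : ℤ)| ≤ k) :=
          fun h => hband h.2.2
        rw [if_pos hij, if_neg hij', if_neg (hne p), if_neg (hne q), A.2.2 i j (not_le.1 hband),
          add_zero, add_zero]
    · rw [if_neg hij, if_neg (by tauto), if_neg (by tauto), add_zero, add_zero]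

end SchurShift

section Derogatory

variable {n k : ℕ}

theorem exists_coordinates_pair {E : Submodule ℂ (Fin n → ℂ)} {p q : Fin n} {u v : Fin n → ℂ}
    (hu : u ∈ E) (hv : v ∈ E) (hup : u p ≠ 0) (hvp : v p = 0) (hvq : v q ≠ 0) (y : Fin n → ℂ) :
    ∃ z ∈ E, ∀ j ∈ ({p, q} : Finset (Fin n)), z j = y j := by
  refine ⟨(y p / u p) • u + ((y q - y p / u p * u q) / v q) • v,
    E.add_mem (E.smul_mem _ hu) (E.smul_mem _ hv), fun j hj => ?_⟩
  rcases Finset.mem_insert.1 hj with rfl | hj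
  · simp [hvp, hup]
  · rw [Finset.mem_singleton.1 hj]
    simp [hvq]

theorem eq_im_mul_I {μ : ℂ} (h : star μ = -μ) : (μ.im : ℂ) * Complex.I = μ := by
  have h := congrArg Complex.re h
  simp only [Complex.star_def, Complex.conj_re, Complex.neg_re] at h
  apply Complex.ext
  · simp
    linarith
  · simp

/-- A choice of coordinates of an eigenspace of `A` presents `A` as a value of `schurShift`. -/
theorem schurShift_pinned_of_coordinates {J : Finset (Fin n)} {p q : Fin n} (hp : p ∈ J)
    (hq : q ∈ J) (hpq : p ≠ q) {A : skewHermitianBanded n k} {μ : ℂ} (hμ : star μ = -μ)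
    (hsurj : ∀ y : Fin n → ℂ,
      ∃ z ∈ Module.End.eigenspace (Matrix.toLin' (A : Matrix (Fin n) (Fin n) ℂ)) μ,
        ∀ j ∈ J, z j = y j)
    (hinj : ∀ z ∈ Module.End.eigenspace (Matrix.toLin' (A : Matrix (Fin n) (Fin n) ℂ)) μ,
      (∀ j ∈ J, z j = 0) → z = 0) :
    pinned p q A μ.im ∈ schurDomain k J p ∧ schurShift k J p q (pinned p q A μ.im) = A := by
  simp only [mem_eigenspace_toLin'] at hsurj hinj
  have hdet := isUnit_det_offBlock A.2.1 hμ hsurj hinj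
  refine schurShift_pinned hp hq hpq ?_ ?_
  · rwa [eq_im_mul_I hμ]
  · rw [eq_im_mul_I hμ]
    exact fun a ha b hb => apply_eq_add_schurTerm hdet hsurj ha hb

theorem star_eq_neg_of_one_lt_finrank {A : Matrix (Fin n) (Fin n) ℂ} (hA : Aᴴ = -A) {μ : ℂ}
    (hμ : 1 < Module.finrank ℂ (Module.End.eigenspace (Matrix.toLin' A) μ)) : star μ = -μ := by
  obtain ⟨p, q, -, u, hu, -, -, hup, -⟩ := exists_pivots hμ
  exact star_eq_neg_of_eigenvector hA (mem_eigenspace_toLin'.1 hu) fun h => hup (by simp [h])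

/-- Every derogatory matrix is a value of some `schurShift` on a subspace of codimension three. -/
theorem exists_mem_image_schurShift (hk : 0 < k) {A : skewHermitianBanded n k}
    (hA : A ∈ derogatorySkewHermitianBanded n k) :
    ∃ (J : Finset (Fin n)) (p q r s : Fin n),
      (p ∈ J ∧ q ∈ J ∧ p ≠ q ∧ r ≠ s ∧ |(s : ℤ) - (r : ℤ)| ≤ k) ∧
      A ∈ schurShift k J p q '' (schurDomain k J p ∩ LinearMap.ker (pinnedMap k q r s)) := by
  obtain ⟨μ, hμ⟩ := hA
  obtain ⟨p, q, hpq, u, hu, v, hv, hup, hvp, hvq, hvlt⟩ := exists_pivots hμ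
  obtain ⟨J, hJ, hsurj, hinj⟩ := exists_coordinates _ (exists_coordinates_pair hu hv hup hvp hvq)
  have hp : p ∈ J := hJ (by simp)
  have hq : q ∈ J := hJ (by simp)
  obtain ⟨h1, h2⟩ := schurShift_pinned_of_coordinates hp hq hpq.ne
    (star_eq_neg_of_one_lt_finrank A.2.1 hμ) hsurj hinj
  have hqq : (pinned p q A μ.im : Matrix (Fin n) (Fin n) ℂ) q q = 0 := by
    simp [pinned_apply, hpq.ne']
  by_cases hband : |(q : ℤ) - (p : ℤ)| ≤ k
  · refine ⟨J, p, q, p, q, ⟨hp, hq, hpq.ne, hpq.ne, hband⟩, _, ⟨h1, ?_⟩, h2⟩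
    exact mem_ker_pinnedMap.2 ⟨hqq, by simp [pinned_apply, hpq.ne']⟩
  · have hpq' : (p : ℕ) < q := hpq
    have hfar : (p : ℕ) + k < q := by
      rw [abs_of_pos (by omega)] at hband
      omega
    let r : Fin n := ⟨q - k, by omega⟩
    have hr : (r : ℕ) = q - k := rfl
    have hrq : (r : ℕ) ≠ q := by omega
    have hrp : (r : ℕ) ≠ p := by omega
    have hrq' : |(q : ℤ) - (r : ℤ)| ≤ k := by
      rw [abs_of_pos (by omega)]
      omega
    refine ⟨J, p, q, r, q, ⟨hp, hq, hpq.ne, fun h => hrq (congrArg Fin.val h), hrq'⟩, _,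
      ⟨h1, ?_⟩, h2⟩
    refine mem_ker_pinnedMap.2 ⟨hqq, ?_⟩
    have hr0 : ¬((r = p ∨ r = q) ∧ (q = p ∨ q = q)) := by
      rintro ⟨h | h, -⟩
      · exact hrp (congrArg Fin.val h)
      · exact hrq (congrArg Fin.val h)
    rw [pinned_apply, if_neg hr0]
    have hrow := congrFun (mem_eigenspace_toLin'.1 hv) r
    have hrltq : r < q := by
      change (r : ℕ) < q
      omega
    rw [Matrix.mulVec, dotProduct, Finset.sum_eq_single q, Pi.smul_apply, hvlt r hrltq,
      smul_zero] at hrow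
    · exact (mul_eq_zero.1 hrow).resolve_right hvq
    · intro j _ hj
      rcases lt_or_gt_of_ne hj with h | h
      · rw [hvlt j h, mul_zero]
      · have h : (q : ℕ) < j := h
        rw [A.2.2 r j, zero_mul]
        rw [abs_of_pos (by omega)]
        omega
    · simp

theorem coveredBySubmanifolds_derogatory (hk : 0 < k) {d : ℕ}
    (hd : Module.finrank ℝ (skewHermitianBanded n k) = d + 3) :
    CoveredBySubmanifolds (derogatorySkewHermitianBanded n k) d := by
  let ι := {c : Finset (Fin n) × Fin n × Fin n × Fin n × Fin n //
    c.2.1 ∈ c.1 ∧ c.2.2.1 ∈ c.1 ∧ c.2.1 ≠ c.2.2.1 ∧ c.2.2.2.1 ≠ c.2.2.2.2 ∧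
      |(c.2.2.2.2 : ℤ) - (c.2.2.2.1 : ℤ)| ≤ k}
  have h : ∀ c : ι, CoveredBySubmanifolds (schurShift k c.1.1 c.1.2.1 c.1.2.2.1 ''
      (schurDomain k c.1.1 c.1.2.1 ∩
        LinearMap.ker (pinnedMap k c.1.2.2.1 c.1.2.2.2.1 c.1.2.2.2.2))) d := by
    rintro ⟨⟨J, p, q, r, s⟩, hp, hq, hpq, hrs, hband⟩
    obtain rfl : d = Module.finrank ℝ (LinearMap.ker (pinnedMap k q r s)) :=
      Nat.add_right_cancel (hd.symm.trans (finrank_ker_pinnedMap hrs hband))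
    exact coveredBySubmanifolds_image (isOpen_schurDomain J p)
      (fun B hB => contDiffAt_schurShift q hB)
      (fun B hB => fderiv_schurShift_injective hp hq hpq hB) _
  refine (CoveredBySubmanifolds.iUnion h).mono fun A hA => ?_
  obtain ⟨J, p, q, r, s, hc, hA⟩ := exists_mem_image_schurShift hk hA
  exact Set.mem_iUnion.2 ⟨⟨⟨J, p, q, r, s⟩, hc⟩, hA⟩

/-- The values of `schurShift` have an eigenspace with arbitrary coordinates `p`, `q`. -/
theorem schurShift_mem_derogatory {p q : Fin n} (hpq : p ≠ q) (hband : |(q : ℤ) - (p : ℤ)| ≤ k)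
    {X : skewHermitianBanded n k} (hX : X ∈ schurDomain k {p, q} p)
    (hF : X ∈ LinearMap.ker (pinnedMap k q p q)) :
    schurShift k {p, q} p q X ∈ derogatorySkewHermitianBanded n k := by
  have hp : p ∈ ({p, q} : Finset (Fin n)) := by simp
  have hq : q ∈ ({p, q} : Finset (Fin n)) := by simp
  obtain ⟨hqq, hXpq⟩ := mem_ker_pinnedMap.1 hF
  have hXqp : (X : Matrix (Fin n) (Fin n) ℂ) q p = 0 := by
    have := star_apply_of_skewHermitian X.2.1 p q
    rwa [hXpq, star_zero, eq_comm, neg_eq_zero] at this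
  set μ := (X : Matrix (Fin n) (Fin n) ℂ) p p with hμ
  set Y := schurShift k {p, q} p q X with hY
  have hc := schurTerm_congr_of_eq_off hp hq (B := (Y : Matrix (Fin n) (Fin n) ℂ)) (B' := X)
    (fun i j hij => by
      rw [hY, schurShift_apply, schurCorrection, if_neg (by tauto), if_neg (by tauto), add_zero,
        add_zero]) μ
  have hdet : IsUnit (offBlock {p, q} (Y : Matrix (Fin n) (Fin n) ℂ) μ).det := by
    rw [hc.2]
    exact hX
  have hband' : |(p : ℤ) - (q : ℤ)| ≤ k := by rwa [abs_sub_comm]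
  have hent : ∀ b ∈ ({p, q} : Finset (Fin n)), ∀ a ∈ ({p, q} : Finset (Fin n)),
      (Y : Matrix (Fin n) (Fin n) ℂ) a b =
        (if a = b then μ else 0) + schurTerm {p, q} (Y : Matrix (Fin n) (Fin n) ℂ) μ a b := by
    intro b hb a ha
    rw [hc.1, hY, schurShift_apply, schurCorrection]
    rcases Finset.mem_insert.1 ha with rfl | ha
    · rcases Finset.mem_insert.1 hb with rfl | hb
      · simp [hpq, hμ]
      · rw [Finset.mem_singleton.1 hb]
        simp [hpq, hXpq, hband, hμ]
    · rw [Finset.mem_singleton.1 ha]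
      rcases Finset.mem_insert.1 hb with rfl | hb
      · simp [hpq, hpq.symm, hXqp, hband', hμ]
      · rw [Finset.mem_singleton.1 hb]
        simp [hqq, hμ, add_comm]
  obtain ⟨u, hu, huJ⟩ := exists_eigenvector_of_schurTerm hdet hp (hent p hp)
  obtain ⟨v, hv, hvJ⟩ := exists_eigenvector_of_schurTerm hdet hq (hent q hq)
  exact isDerogatory_of_eigenvectors (p := p) (q := q) hu hv (by simp [huJ p hp])
    (by simp [hvJ p hp, hpq]) (by simp [hvJ q hq])

/-- An eigenvalue of a perturbed diagonal matrix is close to some diagonal entry, with an index in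
the support of the eigenvector. -/
theorem exists_norm_sub_le_of_eigenvector {A : Matrix (Fin n) (Fin n) ℂ} {d : Fin n → ℂ} {δ : ℝ}
    (hδ : ∀ i j, ‖A i j - Matrix.diagonal d i j‖ ≤ δ) {μ : ℂ} {z : Fin n → ℂ}
    (hz : A *ᵥ z = μ • z) (hz0 : z ≠ 0) : ∃ i, z i ≠ 0 ∧ ‖μ - d i‖ ≤ n * δ := by
  obtain ⟨i₀, hi₀⟩ := Function.ne_iff.1 hz0
  have : Nonempty (Fin n) := ⟨i₀⟩
  obtain ⟨i, hi⟩ := Finite.exists_max fun i => ‖z i‖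
  have hpos : 0 < ‖z i‖ := lt_of_lt_of_le (norm_pos_iff.2 hi₀) (hi i₀)
  refine ⟨i, norm_pos_iff.1 hpos, ?_⟩
  have h1 : (μ - d i) * z i = ∑ j, (A i j - Matrix.diagonal d i j) * z j := by
    have h := congrFun hz i
    have h' := Matrix.mulVec_diagonal d z i
    rw [Matrix.mulVec, dotProduct] at h h'
    simp only [sub_mul, Finset.sum_sub_distrib]
    rw [h, h', Pi.smul_apply, smul_eq_mul]
  have h2 : ‖μ - d i‖ * ‖z i‖ ≤ n * δ * ‖z i‖ := by
    rw [← norm_mul, h1]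
    refine (norm_sum_le _ _).trans ?_
    calc ∑ j, ‖(A i j - Matrix.diagonal d i j) * z j‖ ≤ ∑ _j : Fin n, δ * ‖z i‖ := by
          refine Finset.sum_le_sum fun j _ => ?_
          rw [norm_mul]
          exact mul_le_mul (hδ i j) (hi j) (norm_nonneg _) ((norm_nonneg _).trans (hδ i j))
      _ = n * δ * ‖z i‖ := by simp [mul_assoc]
  exact le_of_mul_le_mul_right h2 hpos

/-- The diagonal entries of a matrix with exactly one multiple eigenvalue, of multiplicity two. -/
noncomputable def modelEntry (i : Fin n) : ℂ :=
  ((if (i : ℕ) ≤ 1 then 0 else i : ℕ) : ℝ) * Complex.I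

theorem one_le_norm_modelEntry_sub {i j : Fin n} (hij : i ≠ j) (hi : 1 < (i : ℕ)) :
    1 ≤ ‖modelEntry i - modelEntry j‖ := by
  have hij' : (i : ℕ) ≠ j := fun h => hij (Fin.ext h)
  rw [modelEntry, modelEntry, ← sub_mul, norm_mul, Complex.norm_I, mul_one, ← Complex.ofReal_sub,
    Complex.norm_real, Real.norm_eq_abs]
  have h : (1 : ℤ) ≤ |((if (i : ℕ) ≤ 1 then 0 else i : ℕ) : ℤ) -
      ((if (j : ℕ) ≤ 1 then 0 else j : ℕ) : ℤ)| := by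
    apply Int.one_le_abs
    split_ifs <;> omega
  exact_mod_cast h

/-- The diagonal matrix with the entries `modelEntry`. -/
noncomputable def modelMatrix (n k : ℕ) : skewHermitianBanded n k :=
  ⟨Matrix.diagonal modelEntry, by
    constructor
    · refine skewHermitian_of_star_apply fun i j => ?_
      rcases eq_or_ne i j with rfl | hij
      · simp [modelEntry]
      · simp [hij, hij.symm]
    · intro i j hij
      refine Matrix.diagonal_apply_ne _ ?_
      rintro rfl
      simp at hij
      omega⟩

/-- Near the model matrix, all derogatory matrices are values of one map `schurShift`. -/
theorem schurShift_pinned_of_near {p q : Fin n} (hp : (p : ℕ) = 0) (hq : (q : ℕ) = 1) {δ : ℝ}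
    (hδ : n * δ < 1 / 2) {A : skewHermitianBanded n k}
    (hA : A ∈ derogatorySkewHermitianBanded n k)
    (hnear : ∀ i j, ‖(A : Matrix (Fin n) (Fin n) ℂ) i j -
      (modelMatrix n k : Matrix (Fin n) (Fin n) ℂ) i j‖ ≤ δ) :
    ∃ t : ℝ, |t| ≤ n * δ ∧ pinned p q A t ∈ schurDomain k {p, q} p ∧
      schurShift k {p, q} p q (pinned p q A t) = A := by
  obtain ⟨μ, hμ⟩ := hA
  have hpq : p ≠ q := fun h => by
    rw [h, hq] at hp
    exact one_ne_zero hp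
  have hex : ∀ z ∈ Module.End.eigenspace (Matrix.toLin' (A : Matrix (Fin n) (Fin n) ℂ)) μ,
      z ≠ 0 → ∃ i, z i ≠ 0 ∧ ‖μ - modelEntry i‖ ≤ n * δ := fun z hz hz0 =>
    exists_norm_sub_le_of_eigenvector hnear (mem_eigenspace_toLin'.1 hz) hz0
  have hclose : ∀ i j : Fin n, ‖μ - modelEntry i‖ ≤ n * δ → ‖μ - modelEntry j‖ ≤ n * δ →
      i ≠ j → (i : ℕ) ≤ 1 := by
    intro i j hi hj hij
    by_contra! h
    have h1 := one_le_norm_modelEntry_sub hij h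
    have h2 := norm_sub_le (μ - modelEntry j) (μ - modelEntry i)
    rw [sub_sub_sub_cancel_left] at h2
    linarith
  have hsmall : ‖μ - modelEntry p‖ ≤ n * δ := by
    obtain ⟨z, hz, hz0, -⟩ := exists_ne_zero_of_one_lt_finrank hμ p
    obtain ⟨i, -, hi⟩ := hex z hz hz0
    obtain ⟨w, hw, hw0, hwi⟩ := exists_ne_zero_of_one_lt_finrank hμ i
    obtain ⟨j, hwj, hj⟩ := hex w hw hw0
    have hij : i ≠ j := by
      rintro rfl
      exact hwj hwi
    have h1 := hclose i j hi hj hij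
    have : modelEntry i = modelEntry p := by simp [modelEntry, h1, hp]
    rwa [this] at hi
  have hinj : ∀ z ∈ Module.End.eigenspace (Matrix.toLin' (A : Matrix (Fin n) (Fin n) ℂ)) μ,
      (∀ j ∈ ({p, q} : Finset (Fin n)), z j = 0) → z = 0 := by
    intro z hz hzJ
    by_contra hz0
    obtain ⟨i, hzi, hi⟩ := hex z hz hz0
    have hip : i ≠ p := by
      rintro rfl
      exact hzi (hzJ _ (by simp))
    have hiq : i ≠ q := by
      rintro rfl
      exact hzi (hzJ _ (by simp))
    have h1 := hclose i p hi hsmall hip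
    have h2 : (i : ℕ) ≠ p := fun h => hip (Fin.ext h)
    have h3 : (i : ℕ) ≠ q := fun h => hiq (Fin.ext h)
    omega
  obtain ⟨u, hu, hu0, huq⟩ := exists_ne_zero_of_one_lt_finrank hμ q
  obtain ⟨v, hv, hv0, hvp⟩ := exists_ne_zero_of_one_lt_finrank hμ p
  have hup : u p ≠ 0 := fun h => hu0 (hinj u hu (by simp [h, huq]))
  have hvq : v q ≠ 0 := fun h => hv0 (hinj v hv (by simp [h, hvp]))
  refine ⟨μ.im, ?_, schurShift_pinned_of_coordinates (by simp) (by simp) hpq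
    (star_eq_neg_of_one_lt_finrank A.2.1 hμ) (exists_coordinates_pair hu hv hup hvp hvq) hinj⟩
  have : modelEntry p = 0 := by simp [modelEntry, hp]
  rw [this, sub_zero] at hsmall
  exact (Complex.abs_im_le_norm μ).trans hsmall

/-- Near the model matrix, the derogatory matrices form a submanifold of codimension three. -/
theorem exists_isEmbeddedSubmanifold_derogatory (hk : 0 < k) {p q : Fin n} (hp : (p : ℕ) = 0)
    (hq : (q : ℕ) = 1) :
    ∃ U : Set (skewHermitianBanded n k), IsOpen U ∧
      (derogatorySkewHermitianBanded n k ∩ U).Nonempty ∧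
      IsEmbeddedSubmanifold (derogatorySkewHermitianBanded n k ∩ U)
        (Module.finrank ℝ (LinearMap.ker (pinnedMap k q p q))) := by
  have hpq : p ≠ q := fun h => by
    rw [h, hq] at hp
    exact one_ne_zero hp
  have hn : (0 : ℝ) < n := Nat.cast_pos.2 (Fin.pos p)
  have hmp : modelEntry p = 0 := by simp [modelEntry, hp]
  have hmq : modelEntry q = 0 := by simp [modelEntry, hq]
  have hband : |(q : ℤ) - (p : ℤ)| ≤ k := by
    rw [hp, hq]
    simpa using Nat.succ_le_of_lt hk
  set A₀ := modelMatrix n k with hA₀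
  have hpin₀ : pinned p q A₀ 0 = A₀ := by
    refine Subtype.ext (Matrix.ext fun i j => ?_)
    rw [pinned_apply]
    change _ = Matrix.diagonal modelEntry i j
    split_ifs with h1 h2
    · simp [h2.1, h2.2, hmp]
    · rcases h1 with ⟨rfl | rfl, rfl | rfl⟩ <;> simp [hpq, hpq.symm, hmp, hmq]
    · rfl
  have hder₀ : A₀ ∈ derogatorySkewHermitianBanded n k := by
    refine isDerogatory_of_eigenvectors (μ := 0) (p := p) (q := q) (u := Pi.single p 1)
      (v := Pi.single q 1) ?_ ?_ (by simp) (by simp [hpq]) (by simp)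
    · change Matrix.diagonal modelEntry *ᵥ _ = _
      simp [hmp]
    · change Matrix.diagonal modelEntry *ᵥ _ = _
      simp [hmq]
  obtain ⟨hdom₀, hT₀⟩ : A₀ ∈ schurDomain k {p, q} p ∧ schurShift k {p, q} p q A₀ = A₀ := by
    obtain ⟨t, ht, h⟩ := schurShift_pinned_of_near (δ := 0) hp hq (by simp) hder₀
      (fun i j => by simp [hA₀])
    rw [mul_zero] at ht
    rw [abs_nonpos_iff.1 ht, hpin₀] at h
    exact h
  obtain ⟨Φ, hsrc₀, hsrc, hΦ, hs₁, hs₂⟩ := exists_smooth_chart (isOpen_schurDomain {p, q} p)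
    (fun B hB => contDiffAt_schurShift q hB)
    (fun B hB => fderiv_schurShift_injective (by simp) (by simp) hpq hB) hdom₀
  have hpin : (fun x : skewHermitianBanded n k × ℝ => pinned p q x.1 x.2) ⁻¹' Φ.source ∈
      nhds (A₀, (0 : ℝ)) := by
    refine (continuous_pinned p q).continuousAt (Φ.open_source.mem_nhds ?_)
    rwa [hpin₀]
  obtain ⟨S, hS, S', hS', hSS'⟩ := mem_nhds_prod_iff.1 hpin
  obtain ⟨ε, hε, hεS'⟩ := Metric.mem_nhds_iff.1 hS'
  obtain ⟨δ, hδ, hδ'⟩ : ∃ δ > 0, n * δ < min ε (1 / 2) := by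
    have h : 0 < min ε (1 / 2) := lt_min hε (by norm_num)
    refine ⟨min ε (1 / 2) / (2 * n), by positivity, ?_⟩
    field_simp
    linarith
  have hnear : ∀ᶠ A : skewHermitianBanded n k in nhds A₀, ∀ i j,
      ‖(A : Matrix (Fin n) (Fin n) ℂ) i j - (A₀ : Matrix (Fin n) (Fin n) ℂ) i j‖ ≤ δ := by
    refine Filter.eventually_all.2 fun i => Filter.eventually_all.2 fun j => ?_
    have h := (entryCLM k i j).continuous.continuousAt (x := A₀)
    filter_upwards [Metric.tendsto_nhds.1 h δ hδ] with A hA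
    rw [dist_eq_norm] at hA
    exact hA.le
  obtain ⟨V, hV, hVo, hAV⟩ := mem_nhds_iff.1 (Filter.inter_mem hS hnear)
  have htgt₀ : A₀ ∈ Φ.target := by
    have := Φ.map_source hsrc₀
    rwa [hΦ, hT₀] at this
  refine ⟨V ∩ Φ.target, hVo.inter Φ.open_target, ⟨A₀, hder₀, hAV, htgt₀⟩,
    isEmbeddedSubmanifold_of_chart Φ hs₁ hs₂ _ (fun A hA => hA.2.2) hVo (fun A hA => hA.2.1)
      fun A hA hAV => ⟨fun h => ?_, fun h => ⟨?_, hAV, hA⟩⟩⟩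
  · obtain ⟨t, ht, hdom, hT⟩ := schurShift_pinned_of_near hp hq
      (hδ'.trans_le (min_le_right _ _)) h.1 (hV hAV).2
    have hsrc' : pinned p q A t ∈ Φ.source := by
      refine hSS' (Set.mk_mem_prod (hV hAV).1 (hεS' ?_))
      rw [Metric.mem_ball, Real.dist_0_eq_abs]
      exact ht.trans_lt (hδ'.trans_le (min_le_left _ _))
    have hsymm : Φ.symm A = pinned p q A t := by
      rw [← Φ.left_inv hsrc', hΦ, hT]
    rw [hsymm]
    exact mem_ker_pinnedMap.2 ⟨by simp [pinned_apply, hpq.symm], by simp [pinned_apply, hpq.symm]⟩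
  · have h1 := schurShift_mem_derogatory hpq hband (hsrc (Φ.map_target hA)) h
    rwa [← hΦ, Φ.right_inv hA] at h1

end Derogatory

theorem mainTheorem8 (n k : ℕ) (hk : 0 < k) (hkn : k < n) :
    HasCodimension (derogatorySkewHermitianBanded n k) 3 := by
  let p : Fin n := ⟨0, by omega⟩
  let q : Fin n := ⟨1, by omega⟩
  have hd := finrank_ker_pinnedMap (k := k) (q := q) (r := p) (s := q)
    (fun h => zero_ne_one (congrArg Fin.val h)) (by simpa [p, q] using Nat.succ_le_of_lt hk)
  exact ⟨_, ⟨exists_isEmbeddedSubmanifold_derogatory hk rfl rfl,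
    (coveredBySubmanifolds_derogatory hk hd).exists_seq⟩, hd⟩
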